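/- Work in Cantor space $2^{\omega}$ with the uniform measure $\lambda$; its elements are called reals. For $W\subseteq 2^{<\omega}$ let $[W]$ be the open class of all reals having an initial segment in $W$, and write $[\sigma]=[\{\sigma\}]$; let $W_e$ be the $e$-th c.e. set of binary strings. A *Demuth test* is a sequence $(S_m)_{m\in\omega}$ with $S_m=[W_{f(m)}]$ and $\lambda S_m\le 2^{-m}$ for all $m$, where $f\le_{\mathrm{wtt}}\emptyset'$. A real $Z$ is *weakly Demuth random* if for every Demuth test $(S_m)$ there is $m$ with $Z\notin S_m$. It is *Martin-Löf random* if the same holds for all tests of this form with $f$ computable, and *weakly 2-random* if it lies in no null (lightface) $\Pi^0_2$ class. A *recursive tree* is a computable set $T\subseteq 2^{<\omega}$ closed under initial segments, and $[T]$ is its set of infinite paths. Boldface $\mathbf{\Pi}^0_2$ sets are the $G_\delta$ sets, and boldface $\mathbf{\Sigma}^0_3$ sets are their countable unions. Let $\mathbb P$ be the partial order, under inclusion, of all recursive trees $T$ such that $[T]\neq\emptyset$ and every element of $[T]$ is Martin-Löf random. A set $D\subseteq\mathbb P$ is dense if every $T\in\mathbb P$ has some $T'\subseteq T$ with $T'\in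 D$. For a family $\mathcal D$ of sets of conditions, a real $x$ is *$\mathcal D$-generic* if there is a filter $F\subseteq\mathbb P$ that meets every dense member of $\mathcal D$ and satisfies $\bigcap_{T\in F}[T]=\{x\}$. "Every sufficiently $\mathbb P$-generic real has property $p$" means that for some countable $\mathcal D$ all $\mathcal D$-generic reals have $p$. Then the following hold. 1. For every recursive tree $T$ such that $[T]$ contains only Martin-Löf random reals, there is a Demuth test $(S_i)_{i\in\omega}$ such that for every $\sigma\in 2^{<\omega}$, if $[\sigma]\cap[T]\ne\emptyset$, then $[\sigma]\cap[T]\cap\bigcap_i S_i\neq\emptyset$. 2. For every $\mathbf{\Pi}^0_2$ set $G$ containing only weakly Demuth random reals, the set $\{P\in\mathbb P: [P]\cap G=\emptyset\}$ is dense in $\mathbb P$. 3. $\mathbb P$ is nonempty; for every countable $\mathcal D$ and every $P\in\mathbb P$ there is a $\mathcal D$-generic real in $[P]$; and every sufficiently $\mathbb P$-generic real is weakly 2-random and weakly Demuth random. 4. For every $\mathbf{\Sigma}^0_3$ set $H$ containing only weakly Demuth random reals, every sufficiently $\mathbb P$-generic real lies outside $H$; in particular there is a weakly Demuth random real that is not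 in $H$. 5. Consequently the set of weakly Demuth random reals is not $\mathbf{\Sigma}^0_3$. -/

import Mathlib

open MeasureTheory
open scoped ENNReal

namespace WeakDemuth

/-- Cantor space, with the product topology; its points are the reals (sets of natural numbers). -/
abbrev Cantor : Type := ℕ → Bool

/-- The initial segment of `Z` of length `n`. -/
def initSeg (Z : Cantor) (n : ℕ) : List Bool := (List.range n).map Z

/-- The open class generated by a set of binary strings. -/
def openClass (W : Set (List Bool)) : Set Cantor := {Z | ∃ n, initSeg Z n ∈ W}

/-- The cylinder of all reals that extend the string `σ`. -/
def cylinder (σ : List Bool) : Set Cantor := {Z | initSeg Z σ.length = σ}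

/-- The uniform (fair coin) measure on Cantor space. -/
noncomputable def coinMeasure : Measure Cantor :=
  Measure.infinitePi fun _ : ℕ => (PMF.uniformOfFintype Bool).toMeasure

/-- The `e`-th c.e. set of binary strings: the domain of the `e`-th partial recursive function. -/
def ceSet (e : ℕ) : Set (List Bool) :=
  {σ | ((Denumerable.ofNat Nat.Partrec.Code e).eval (Encodable.encode σ)).Dom}

open Classical in
/-- The (characteristic function of the) halting problem `∅' = {e : φ_e(e) is defined}`. -/
noncomputable def halting : Cantor := fun e =>
  decide ((Denumerable.ofNat Nat.Partrec.Code e).eval e).Dom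

/-- Weak truth-table reducibility of a function to a set: `f(x)` is computed, by a fixed partial
recursive procedure, from `x` and the initial segment of `A` of length `h(x)`, where the bound `h`
on the use is a computable function. -/
def WttReducible (f : ℕ → ℕ) (A : Cantor) : Prop :=
  ∃ h : ℕ → ℕ, Computable h ∧
    ∃ ψ : ℕ × List Bool →. ℕ, Partrec ψ ∧ ∀ x, f x ∈ ψ (x, initSeg A (h x))

/-- A Demuth test. -/
def IsDemuthTest (S : ℕ → Set Cantor) : Prop :=
  (∀ m, coinMeasure (S m) ≤ (2 : ℝ≥0∞)⁻¹ ^ m) ∧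
    ∃ f : ℕ → ℕ, WttReducible f halting ∧ ∀ m, S m = openClass (ceSet (f m))

/-- `Z` is weakly Demuth random: no Demuth test has `Z` in all its components. -/
def WeaklyDemuthRandom (Z : Cantor) : Prop :=
  ∀ S : ℕ → Set Cantor, IsDemuthTest S → ∃ m, Z ∉ S m

/-- A Martin-Löf test: uniformly c.e. open classes with the `m`-th of measure at most `2⁻ᵐ`. -/
def IsMLTest (S : ℕ → Set Cantor) : Prop :=
  (∀ m, coinMeasure (S m) ≤ (2 : ℝ≥0∞)⁻¹ ^ m) ∧
    ∃ f : ℕ → ℕ, Computable f ∧ ∀ m, S m = openClass (ceSet (f m))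

/-- Martin-Löf randomness. -/
def MLRandom (Z : Cantor) : Prop :=
  ∀ S : ℕ → Set Cantor, IsMLTest S → ∃ m, Z ∉ S m

/-- Weak 2-randomness: `Z` lies in no null (lightface) `Π⁰₂` class, that is, in no null class that
is the intersection of a uniformly c.e. sequence of open classes. -/
def WeaklyTwoRandom (Z : Cantor) : Prop :=
  ∀ f : ℕ → ℕ, Computable f → coinMeasure (⋂ m, openClass (ceSet (f m))) = 0 →
    Z ∉ ⋂ m, openClass (ceSet (f m))

/-- A recursive tree: a computable set of binary strings that is closed under initial segments
(dead ends are allowed). -/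
def IsRecursiveTree (T : Set (List Bool)) : Prop :=
  (ComputablePred fun σ => σ ∈ T) ∧ ∀ σ τ : List Bool, σ <+: τ → τ ∈ T → σ ∈ T

/-- The class `[T]` of infinite paths of `T`. -/
def paths (T : Set (List Bool)) : Set Cantor := {Z | ∀ n, initSeg Z n ∈ T}

/-- Forcing conditions: recursive trees that have a path and have only Martin-Löf random paths. -/
structure MLTree where
  tree : Set (List Bool)
  recursive : IsRecursiveTree tree
  nonempty : (paths tree).Nonempty
  random : ∀ Z ∈ paths tree, MLRandom Z

/-- Conditions are ordered by inclusion of trees. -/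
instance : Preorder MLTree := Preorder.lift MLTree.tree

/-- A set of conditions is dense if every condition is extended by one in the set. -/
def ForcingDense (D : Set MLTree) : Prop := ∀ P : MLTree, ∃ Q ∈ D, Q ≤ P

/-- `x` is generic for the family `𝒟`: some filter of conditions meets every dense set in `𝒟`, and
`x` is the one real that is a path of every tree in the filter. -/
def GenericFor (𝒟 : Set (Set MLTree)) (x : Cantor) : Prop :=
  ∃ F : Order.PFilter MLTree, (∀ D ∈ 𝒟, ForcingDense D → ∃ P ∈ F, P ∈ D) ∧
    (⋂ P ∈ F, paths P.tree) = {x}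

/-- Every sufficiently generic real satisfies `p`. -/
def SufficientlyGenericAre (p : Cantor → Prop) : Prop :=
  ∃ 𝒟 : Set (Set MLTree), 𝒟.Countable ∧ ∀ x, GenericFor 𝒟 x → p x

/-- Boldface `Π⁰₂` subsets of Cantor space. -/
def BoldPi02 (G : Set Cantor) : Prop := IsGδ G

/-- Boldface `Σ⁰₃` subsets of Cantor space: countable unions of boldface `Π⁰₂` sets. -/
def BoldSigma03 (H : Set Cantor) : Prop :=
  ∃ G : ℕ → Set Cantor, (∀ n, BoldPi02 (G n)) ∧ H = ⋃ n, G n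

end WeakDemuth

namespace WeakDemuth

open Nat.Partrec (Code)
open Encodable (encode decode)

/-! The engine is effective Baire category. Let `K` be an effectively closed class, the intersection
of a decreasing computable sequence of clopen stages. For each `m` there is a Demuth test component
that is dense in `K`. With `∅'` find a stage exceeding `K` in measure by at most `2⁻¹ ^ (m + 1)`;
anything enumerated inside that stage but off `K` then costs little. For each string `σ`, guess the
least long extension of `σ` that still looks alive, and enumerate alive strings above the current
guess. On `K` only the correct guess survives, so `σ` contributes at most one short cylinder there.
The `∅'`-computation has computably bounded use: finitely many questions "does the measure ever drop
below a given dyadic rational?" suffice (`exists_wttReducible_of_stage`, `exists_demuthTest_dense`).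

By Baire, the intersection of the components is a `Gδ` set dense in `K`, and it contains no weakly
Demuth random real. A `Gδ` set `G` of weakly Demuth randoms therefore cannot be dense in the paths
of any condition; restricting the condition to a suitable cylinder avoids `G`
(`forcingDense_avoid_of_isGδ`).

Null intersections of c.e. open classes can also be avoided, since conditions have positive measure
(`forcingDense_avoid_null`). Only countably many tests exist, so a generic real passes all of them
while escaping countably many sets `G n`. Generic reals exist by Rasiowa–Sikorski and compactness
(`exists_genericFor`). -/

@[simp] lemma length_initSeg (Z : Cantor) (n : ℕ) : (initSeg Z n).length = n := by
  simp [initSeg]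

lemma take_initSeg (Z : Cantor) {m n : ℕ} (h : m ≤ n) : (initSeg Z n).take m = initSeg Z m := by
  simp [initSeg, ← List.map_take, List.take_range, h]

lemma initSeg_prefix (Z : Cantor) {m n : ℕ} (h : m ≤ n) : initSeg Z m <+: initSeg Z n :=
  take_initSeg Z h ▸ List.take_prefix _ _

lemma initSeg_eq_iff {Z Y : Cantor} {n : ℕ} : initSeg Z n = initSeg Y n ↔ ∀ i < n, Z i = Y i := by
  simp [initSeg]

/-- The real that extends `σ` by zeros. -/
def padded (σ : List Bool) : Cantor := fun i => σ.getD i false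

lemma initSeg_padded (σ : List Bool) : initSeg (padded σ) σ.length = σ := by
  apply List.ext_getElem <;> simp +contextual [initSeg, padded]

lemma initSeg_eq_iff_mem_cylinder {Z : Cantor} {σ : List Bool} {n : ℕ} (h : σ.length = n) :
    initSeg Z n = σ ↔ Z ∈ cylinder σ := by
  subst h; rfl

/-! ### Topology and measure of classes determined by initial segments -/

lemma isOpen_initSeg_preimage (n : ℕ) (A : Set (List Bool)) : IsOpen {Z | initSeg Z n ∈ A} := by
  rw [isOpen_iff_forall_mem_open]
  intro Z hZ
  refine ⟨{Y | ∀ i ∈ Finset.range n, Y i = Z i}, ?_, ?_, ?_⟩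
  · intro Y hY
    have : initSeg Y n = initSeg Z n := initSeg_eq_iff.2 fun i hi => hY i (Finset.mem_range.2 hi)
    simpa [this] using hZ
  · have : {Y : Cantor | ∀ i ∈ Finset.range n, Y i = Z i}
        = ⋂ i ∈ Finset.range n, (fun Y : Cantor => Y i) ⁻¹' {Z i} := by
      ext; simp
    rw [this]
    exact isOpen_biInter_finset fun i _ => (isOpen_discrete _).preimage (continuous_apply i)
  · simp

lemma isClosed_initSeg_preimage (n : ℕ) (A : Set (List Bool)) :
    IsClosed {Z | initSeg Z n ∈ A} :=
  ⟨isOpen_initSeg_preimage n Aᶜ⟩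

lemma isOpen_cylinder (σ : List Bool) : IsOpen (cylinder σ) :=
  isOpen_initSeg_preimage σ.length {σ}

lemma isClosed_cylinder (σ : List Bool) : IsClosed (cylinder σ) :=
  isClosed_initSeg_preimage σ.length {σ}

lemma isOpen_openClass (W : Set (List Bool)) : IsOpen (openClass W) := by
  have : openClass W = ⋃ n, {Z | initSeg Z n ∈ W} := by ext; simp [openClass]
  rw [this]
  exact isOpen_iUnion fun n => isOpen_initSeg_preimage n W

lemma exists_cylinder_subset {U : Set Cantor} (hU : IsOpen U) {Z : Cantor} (hZ : Z ∈ U) :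
    ∃ n, cylinder (initSeg Z n) ⊆ U := by
  rw [isOpen_pi_iff] at hU
  obtain ⟨I, u, hu, hsub⟩ := hU Z hZ
  refine ⟨I.sup id + 1, fun Y hY => hsub fun i hi => ?_⟩
  have hY' : initSeg Y (I.sup id + 1) = initSeg Z (I.sup id + 1) := by
    simpa [cylinder] using hY
  rw [initSeg_eq_iff.1 hY' i (Nat.lt_succ_of_le (Finset.le_sup (f := id) hi))]
  exact (hu i hi).2

instance : IsProbabilityMeasure coinMeasure := by
  unfold coinMeasure; infer_instance

lemma coinMeasure_cylinder (σ : List Bool) : coinMeasure (cylinder σ) = 2⁻¹ ^ σ.length := by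
  have : cylinder σ
      = Set.pi (Finset.range σ.length : Set ℕ) (fun i => {padded σ i}) := by
    ext Z
    rw [cylinder, Set.mem_ofPred_eq]
    conv_lhs => rw [← initSeg_padded σ]
    simp only [length_initSeg]
    rw [initSeg_eq_iff]
    simp [Set.mem_pi]
  rw [this, coinMeasure, Measure.infinitePi_pi _ (fun _ _ => MeasurableSet.singleton _)]
  simp

/-- The list of all binary strings of length `n`. -/
def allStrings : ℕ → List (List Bool)
  | 0 => [[]]
  | n + 1 => (allStrings n).map (List.cons false) ++ (allStrings n).map (List.cons true)

@[simp] lemma mem_allStrings {n : ℕ} {σ : List Bool} : σ ∈ allStrings n ↔ σ.length = n := by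
  induction n generalizing σ with
  | zero => simp [allStrings]
  | succ n ih =>
    rcases σ with _ | ⟨b, σ⟩
    · simp [allStrings]
    · cases b <;> simp [allStrings, ih]

lemma nodup_allStrings (n : ℕ) : (allStrings n).Nodup := by
  induction n with
  | zero => simp [allStrings]
  | succ n ih =>
    refine List.Nodup.append (ih.map (List.cons_injective)) (ih.map (List.cons_injective)) ?_
    intro σ h1 h2
    simp only [List.mem_map] at h1 h2
    obtain ⟨a, -, rfl⟩ := h1
    obtain ⟨b, -, h⟩ := h2
    simp at h

@[simp] lemma length_allStrings (n : ℕ) : (allStrings n).length = 2 ^ n := by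
  induction n with
  | zero => simp [allStrings]
  | succ n ih => simp [allStrings, ih]; ring

lemma coinMeasure_initSeg_preimage (n : ℕ) (p : List Bool → Prop) [DecidablePred p] :
    coinMeasure {Z | p (initSeg Z n)} = ((allStrings n).filter (p ·)).length * 2⁻¹ ^ n := by
  have hset : {Z | p (initSeg Z n)}
      = ⋃ σ ∈ ((allStrings n).filter (p ·)).toFinset, cylinder σ := by
    ext Z
    simp only [Set.mem_ofPred_eq, List.mem_toFinset, List.mem_filter, mem_allStrings,
      decide_eq_true_eq, Set.mem_iUnion, exists_prop]
    constructor
    · intro h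
      exact ⟨_, ⟨length_initSeg Z n, h⟩, by simp [cylinder]⟩
    · rintro ⟨σ, ⟨rfl, h⟩, hZ⟩
      rw [cylinder, Set.mem_ofPred_eq] at hZ
      rwa [hZ]
  rw [hset, measure_biUnion_finset]
  · rw [Finset.sum_congr rfl (g := fun _ => (2 : ℝ≥0∞)⁻¹ ^ n)]
    · rw [Finset.sum_const, List.toFinset_card_of_nodup ((nodup_allStrings n).filter _),
        nsmul_eq_mul]
    · intro σ hσ
      simp only [List.mem_toFinset, List.mem_filter, mem_allStrings] at hσ
      rw [coinMeasure_cylinder, hσ.1]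
  · intro σ hσ τ hτ hne
    simp only [Finset.mem_coe, List.mem_toFinset, List.mem_filter, mem_allStrings] at hσ hτ
    refine Set.disjoint_left.2 fun Z h1 h2 => hne ?_
    rw [← (initSeg_eq_iff_mem_cylinder hσ.1).2 h1, ← (initSeg_eq_iff_mem_cylinder hτ.1).2 h2]
  · exact fun σ _ => (isOpen_cylinder σ).measurableSet

/-! ### Relative density and Baire category -/

/-- A set is dense in `K` when it meets every cylinder that meets `K` inside `K`. -/
def DenseInside (K A : Set Cantor) : Prop :=
  ∀ σ, (cylinder σ ∩ K).Nonempty → (cylinder σ ∩ K ∩ A).Nonempty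

lemma DenseInside.dense_preimage {K A : Set Cantor} (h : DenseInside K A) :
    Dense ((↑) ⁻¹' A : Set K) := by
  rw [dense_iff_inter_open]
  rintro U hU ⟨⟨Z, hZK⟩, hZU⟩
  obtain ⟨V, hV, rfl⟩ := isOpen_induced_iff.1 hU
  obtain ⟨n, hn⟩ := exists_cylinder_subset hV hZU
  obtain ⟨Y, ⟨hY, hYK⟩, hYA⟩ := h (initSeg Z n) ⟨Z, by simp [cylinder], hZK⟩
  exact ⟨⟨Y, hYK⟩, hn hY, hYA⟩

/-- A closed subset of Cantor space is compact Hausdorff, hence a Baire space in its own right; the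
intersection is taken in that subspace. -/
lemma denseInside_iInter {ι : Type*} [Countable ι] {K : Set Cantor} (hK : IsClosed K)
    {A : ι → Set Cantor} (hA : ∀ i, IsGδ (A i)) (h : ∀ i, DenseInside K (A i)) :
    DenseInside K (⋂ i, A i) := by
  have : CompactSpace K := isCompact_iff_compactSpace.1 hK.isCompact
  have hd : Dense (⋂ i, ((↑) ⁻¹' A i : Set K)) :=
    dense_iInter_of_Gδ (fun i => (hA i).preimage continuous_subtype_val)
      fun i => (h i).dense_preimage
  rintro σ ⟨Z, hZσ, hZK⟩
  obtain ⟨Y, hYσ, hYA⟩ := hd.inter_open_nonempty ((↑) ⁻¹' cylinder σ : Set K)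
    ((isOpen_cylinder σ).preimage continuous_subtype_val) ⟨⟨Z, hZK⟩, by exact hZσ⟩
  exact ⟨Y, ⟨hYσ, Y.2⟩, by simpa using hYA⟩

/-! ### Primitive recursive predicates, indices and halting queries -/

section Primrec

variable {α β : Type*} [Primcodable α] [Primcodable β]

lemma primrecPred_exists_mem {l : α → List β} {p : α → β → Prop} (hl : Primrec l)
    (hp : PrimrecPred fun x : α × β => p x.1 x.2) : PrimrecPred fun a => ∃ b ∈ l a, p a b :=
  PrimrecRel.comp (PrimrecRel.exists_mem_list (R := fun b a => p a b)
    (hp.comp (Primrec.snd.pair Primrec.fst))) hl Primrec.id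

lemma primrecPred_forall_mem {l : α → List β} {p : α → β → Prop} (hl : Primrec l)
    (hp : PrimrecPred fun x : α × β => p x.1 x.2) : PrimrecPred fun a => ∀ b ∈ l a, p a b :=
  PrimrecRel.comp (PrimrecRel.forall_mem_list (R := fun b a => p a b)
    (hp.comp (Primrec.snd.pair Primrec.fst))) hl Primrec.id

lemma primrecPred_exists_lt {f : α → ℕ} {p : α → ℕ → Prop} (hf : Primrec f)
    (hp : PrimrecPred fun x : α × ℕ => p x.1 x.2) : PrimrecPred fun a => ∃ n < f a, p a n :=
  (primrecPred_exists_mem (Primrec.list_range.comp hf) hp).of_eq fun a => by simp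

lemma primrecPred_forall_lt {f : α → ℕ} {p : α → ℕ → Prop} (hf : Primrec f)
    (hp : PrimrecPred fun x : α × ℕ => p x.1 x.2) : PrimrecPred fun a => ∀ n < f a, p a n :=
  (primrecPred_forall_mem (Primrec.list_range.comp hf) hp).of_eq fun a => by simp

lemma primrecPred_imp {p q : α → Prop} (hp : PrimrecPred p) (hq : PrimrecPred q) :
    PrimrecPred fun a => p a → q a :=
  (hp.not.or hq).of_eq fun a => by tauto

lemma primrec_allStrings : Primrec allStrings := by
  have h (b : Bool) : Primrec fun x : ℕ × List (List Bool) => x.2.map (List.cons b) :=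
    Primrec.list_map Primrec.snd (Primrec.list_cons.comp (Primrec.const b) Primrec.snd).to₂
  have := Primrec.nat_rec₁ [[]] (f := fun _ l => l.map (List.cons false) ++ l.map (List.cons true))
    (Primrec.list_append.comp (h false) (h true)).to₂
  refine this.of_eq fun n => ?_
  induction n with
  | zero => rfl
  | succ n ih => simp only [allStrings, ← ih]

lemma primrec_two_pow : Primrec fun n : ℕ => 2 ^ n :=
  (Primrec.list_length.comp primrec_allStrings).of_eq fun n => by simp

lemma primrecRel_prefix : PrimrecRel fun σ τ : List Bool => σ <+: τ :=
  (Primrec.eq.comp Primrec.fst (Primrec.list_take.comp (Primrec.list_length.comp Primrec.fst)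
    Primrec.snd)).of_eq fun _ => List.prefix_iff_eq_take.symm

lemma rePred_exists {p : α → ℕ → Prop} (hp : PrimrecPred fun x : α × ℕ => p x.1 x.2) :
    REPred fun a => ∃ n, p a n := by
  classical
  have h : Partrec fun a => Nat.rfind fun n => Part.some (decide (p a n)) :=
    Partrec.rfind hp.decide.to_comp.partrec
  refine h.dom_re.of_eq fun a => Nat.rfind_dom.trans ?_
  simp [Part.some_dom]

/-- The parameter theorem for relations: a c.e. relation has a uniformly primitive recursive
family of indices for its sections. -/
lemma exists_index {p : α → β → Prop} (hp : REPred fun x : α × β => p x.1 x.2) :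
    ∃ g : α → ℕ, Primrec g ∧
      ∀ a b, ((Denumerable.ofNat Code (g a)).eval (encode b)).Dom ↔ p a b := by
  obtain ⟨c, hc⟩ := Code.exists_code.1 hp
  refine ⟨fun a => encode (c.curry (encode a)), ?_, fun a b => ?_⟩
  · exact Primrec.encode.comp (Code.primrec₂_curry.comp (Primrec.const c) Primrec.encode)
  · rw [Denumerable.ofNat_encode, Code.eval_curry, hc]
    have : Nat.pair (encode a) (encode b) = encode (a, b) := by simp
    rw [this]
    beta_reduce
    rw [Encodable.encodek]
    simp [Part.assert]

lemma exists_ceSet_index {R : α → Set (List Bool)}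
    (hR : REPred fun x : α × List Bool => x.2 ∈ R x.1) :
    ∃ g : α → ℕ, Primrec g ∧ ∀ a, ceSet (g a) = R a := by
  obtain ⟨g, hg, h⟩ := exists_index (p := fun a σ => σ ∈ R a) hR
  exact ⟨g, hg, fun a => Set.ext fun σ => h a σ⟩

lemma exists_halting_query {p : α → Prop} (hp : REPred p) :
    ∃ q : α → ℕ, Primrec q ∧ ∀ a, halting (q a) = true ↔ p a := by
  -- The dummy second argument lets the program ignore its input, so running it on its own index, as
  -- `halting` does, decides `p a`.
  have : REPred fun x : α × ℕ => p x.1 :=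
    Partrec.comp (f := fun a => Part.assert (p a) fun _ => Part.some ()) hp Computable.fst
  obtain ⟨q, hq, h⟩ := exists_index (p := fun a _ => p a) this
  exact ⟨q, hq, fun a => by simpa [halting] using h a (q a)⟩

end Primrec

/-! ### Clopen approximations to effectively closed classes -/

/-- The strings with an initial segment that is enumerated into `ceSet e` before the stage given
by the length of the string. -/
def enumerated (e : ℕ) : Set (List Bool) :=
  {σ | ∃ n < σ.length + 1,
    (Code.evaln σ.length (Denumerable.ofNat Code e) (encode (σ.take n))).isSome = true}

lemma primrec_enumerated : PrimrecRel fun (e : ℕ) (σ : List Bool) => σ ∈ enumerated e := by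
  refine primrecPred_exists_lt (Primrec.succ.comp (Primrec.list_length.comp Primrec.snd)) ?_
  refine PrimrecPred.of_eq (p := fun x => _ = true) (Primrec.eq.comp (Primrec.option_isSome.comp
    (Code.primrec_evaln.comp (((Primrec.list_length.comp (Primrec.snd.comp Primrec.fst)).pair
      ((Primrec.ofNat Code).comp (Primrec.fst.comp Primrec.fst))).pair
      (Primrec.encode.comp (Primrec.list_take.comp Primrec.snd (Primrec.snd.comp Primrec.fst)))))) 
      (Primrec.const true)) fun x => Iff.rfl

lemma enumerated_of_prefix {e : ℕ} {σ τ : List Bool} (h : σ <+: τ) (hσ : σ ∈ enumerated e) :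
    τ ∈ enumerated e := by
  obtain ⟨n, hn, hs⟩ := hσ
  have hlen := h.length_le
  obtain ⟨x, hx⟩ := Option.isSome_iff_exists.1 hs
  refine ⟨n, by omega, Option.isSome_iff_exists.2 ⟨x, ?_⟩⟩
  have : τ.take n = σ.take n := by
    rw [List.prefix_iff_eq_take.1 h, List.take_take, min_eq_left (by omega)]
  rw [this]
  exact Code.evaln_mono hlen hx

/-- Delaying an enumerated string to longer extensions does not change the open class. This replaces
a c.e. set of generators by a decidable one closed under extension, with string length serving as
the stage. -/
lemma openClass_ceSet (e : ℕ) : openClass (ceSet e) = openClass (enumerated e) := by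
  ext Z
  constructor
  · rintro ⟨n, hn⟩
    obtain ⟨x, hx⟩ := Part.dom_iff_mem.1 (show Part.Dom _ from hn)
    obtain ⟨k, hk⟩ := Code.evaln_complete.1 hx
    refine ⟨max n k, n, by simp, Option.isSome_iff_exists.2 ⟨x, ?_⟩⟩
    rw [take_initSeg _ (le_max_left _ _), length_initSeg]
    exact Code.evaln_mono (le_max_right _ _) hk
  · rintro ⟨k, n, hn, hs⟩
    obtain ⟨x, hx⟩ := Option.isSome_iff_exists.1 hs
    rw [length_initSeg] at hn
    rw [take_initSeg _ (by omega)] at hx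
    exact ⟨n, Part.dom_iff_mem.2 ⟨x, Code.evaln_sound hx⟩⟩

/-- The clopen set of reals not enumerated into `openClass (ceSet e)` by stage `s`. -/
def stage (e s : ℕ) : Set Cantor := {Z | initSeg Z s ∉ enumerated e}

lemma stage_antitone (e : ℕ) : Antitone (stage e) :=
  fun _ _ h Z hZ hs => hZ (enumerated_of_prefix (initSeg_prefix Z h) hs)

lemma isClosed_stage (e s : ℕ) : IsClosed (stage e s) :=
  isClosed_initSeg_preimage s (enumerated e)ᶜ

lemma iInter_stage (e : ℕ) : ⋂ s, stage e s = (openClass (ceSet e))ᶜ := by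
  rw [openClass_ceSet]; ext Z; simp [openClass, stage]

open Classical in
/-- The number of strings of length `s` not enumerated by stage `s`. -/
noncomputable def aliveCount (e s : ℕ) : ℕ :=
  ((allStrings s).filter fun σ => decide (σ ∉ enumerated e)).length

lemma primrec_aliveCount : Primrec₂ aliveCount := by
  classical
  refine Primrec.list_length.comp ((PrimrecRel.listFilter (R := fun σ e => σ ∉ enumerated e)
    (primrec_enumerated.swap.not)).comp (primrec_allStrings.comp Primrec.snd) Primrec.fst) |>.of_eq
      fun x => by simp [aliveCount]

lemma coinMeasure_stage (e s : ℕ) :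
    coinMeasure (stage e s) = aliveCount e s * 2⁻¹ ^ s := by
  classical
  exact coinMeasure_initSeg_preimage s (· ∉ enumerated e)

lemma tsum_two_inv_pow_add (k : ℕ) : ∑' n : ℕ, (2 : ℝ≥0∞)⁻¹ ^ (n + (k + 1)) = 2⁻¹ ^ k := by
  simp_rw [pow_add _ _ (k + 1)]
  rw [ENNReal.tsum_mul_right, ENNReal.tsum_geometric, ENNReal.one_sub_inv_two, inv_inv,
    pow_succ', ← mul_assoc, ENNReal.mul_inv_cancel two_ne_zero ENNReal.ofNat_ne_top, one_mul]

/-! ### Open classes dense in an effectively closed class -/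

/-- `ρ` extends the least (in the order of codes) among the strings of length `L` that extend `σ`
and have an extension of length `|ρ|` which is not enumerated. -/
def Selects (e L : ℕ) (σ ρ : List Bool) : Prop :=
  L ≤ ρ.length ∧ ∀ τ ∈ allStrings L, σ <+: τ → encode τ < encode (ρ.take L) →
    ∀ π ∈ allStrings ρ.length, τ <+: π → π ∈ enumerated e

/-- The length of the extensions of `σ` considered in the `m`-th component. -/
def selectLength (m : ℕ) (σ : List Bool) : ℕ := σ.length + (encode σ + (m + 2))

/-- The strings that generate the component `m` of the test, started at stage `s`. -/
def denseStrings (e m s : ℕ) : Set (List Bool) :=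
  {ρ | s ≤ ρ.length ∧ ρ ∉ enumerated e ∧
    ∃ n < ρ.length + 1, Selects e (selectLength m (ρ.take n)) (ρ.take n) ρ}

lemma primrec_selectLength : Primrec₂ selectLength := by
  unfold selectLength
  exact Primrec.nat_add.comp (Primrec.list_length.comp Primrec.snd)
    (Primrec.nat_add.comp (Primrec.encode.comp Primrec.snd)
      (Primrec.nat_add.comp Primrec.fst (Primrec.const 2)))

lemma primrec_selects :
    PrimrecPred fun x : (ℕ × ℕ) × List Bool × List Bool => Selects x.1.1 x.1.2 x.2.1 x.2.2 := by
  refine (Primrec.nat_le.comp (Primrec.snd.comp Primrec.fst)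
    (Primrec.list_length.comp (Primrec.snd.comp Primrec.snd))).and ?_
  refine primrecPred_forall_mem
    (primrec_allStrings.comp (Primrec.snd.comp Primrec.fst)) ?_
  refine primrecPred_imp
    (primrecRel_prefix.comp ((Primrec.fst.comp Primrec.snd).comp Primrec.fst) Primrec.snd) ?_
  refine primrecPred_imp (Primrec.nat_lt.comp (Primrec.encode.comp Primrec.snd)
    (Primrec.encode.comp (Primrec.list_take.comp ((Primrec.snd.comp Primrec.fst).comp Primrec.fst)
      ((Primrec.snd.comp Primrec.snd).comp Primrec.fst)))) ?_
  refine primrecPred_forall_mem (primrec_allStrings.comp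
    (Primrec.list_length.comp ((Primrec.snd.comp Primrec.snd).comp Primrec.fst))) ?_
  exact primrecPred_imp (primrecRel_prefix.comp (Primrec.snd.comp Primrec.fst) Primrec.snd)
    (primrec_enumerated.comp ((Primrec.fst.comp Primrec.fst).comp (Primrec.fst.comp Primrec.fst))
      Primrec.snd)

lemma primrec_denseStrings (e : ℕ) :
    PrimrecPred fun x : (ℕ × ℕ) × List Bool => x.2 ∈ denseStrings e x.1.1 x.1.2 := by
  refine (Primrec.nat_le.comp (Primrec.snd.comp Primrec.fst)
    (Primrec.list_length.comp Primrec.snd)).and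
      ((primrec_enumerated.comp (Primrec.const e) Primrec.snd).not.and ?_)
  refine primrecPred_exists_lt (Primrec.succ.comp (Primrec.list_length.comp Primrec.snd)) ?_
  have ht : Primrec fun x : ((ℕ × ℕ) × List Bool) × ℕ => x.1.2.take x.2 :=
    Primrec.list_take.comp Primrec.snd (Primrec.snd.comp Primrec.fst)
  exact primrec_selects.comp (((Primrec.const e).pair (primrec_selectLength.comp
    ((Primrec.fst.comp Primrec.fst).comp Primrec.fst) ht)).pair
      (ht.pair (Primrec.snd.comp Primrec.fst)))

/-- A generator is alive at a stage at least `s`, so the part of the class off `K` lies in `stage e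
s \ K`. Within `K`, wrong guesses are never selected, so each `σ` contributes at most one cylinder,
and the selected lengths make these sum to at most `2⁻¹ ^ (m + 1)`. -/
lemma measure_openClass_denseStrings_le (e m s : ℕ) :
    coinMeasure (openClass (denseStrings e m s)) ≤
      coinMeasure (stage e s \ (openClass (ceSet e))ᶜ) + 2⁻¹ ^ (m + 1) := by
  set K := (openClass (ceSet e))ᶜ with hK
  have hKs (Z) (hZ : Z ∈ K) (n) : initSeg Z n ∉ enumerated e := by
    rw [hK, ← iInter_stage] at hZ
    exact Set.mem_iInter.1 hZ n
  let A (σ : List Bool) : Set Cantor :=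
    {Z | Z ∈ K ∧ Z ∈ cylinder σ ∧ ∃ t, Selects e (selectLength m σ) σ (initSeg Z t)}
  have hA (σ) : coinMeasure (A σ) ≤ 2⁻¹ ^ (selectLength m σ) := by
    rcases (A σ).eq_empty_or_nonempty with h | ⟨Y, hYK, hYσ, t, hY⟩
    · simp [h]
    · have key : ∀ Z ∈ A σ, ∀ Z' ∈ A σ, ¬ encode (initSeg Z' (selectLength m σ)) <
          encode (initSeg Z (selectLength m σ)) := by
        rintro Z ⟨-, -, t, hL, ht⟩ Z' ⟨hZ'K, hZ'σ, -⟩ hlt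
        rw [length_initSeg] at hL
        refine hKs Z' hZ'K t (ht _ (by simp) ?_ (by rwa [take_initSeg _ hL]) _ (by simp)
          (initSeg_prefix _ hL))
        have hpre := initSeg_prefix Z' (show σ.length ≤ selectLength m σ from Nat.le_add_right _ _)
        rwa [(initSeg_eq_iff_mem_cylinder rfl).2 hZ'σ] at hpre
      have hYA : Y ∈ A σ := ⟨hYK, hYσ, t, hY⟩
      calc coinMeasure (A σ) ≤ coinMeasure (cylinder (initSeg Y (selectLength m σ))) := by
            refine measure_mono fun Z hZ => (initSeg_eq_iff_mem_cylinder (length_initSeg _ _)).1 ?_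
            exact Encodable.encode_injective
              (le_antisymm (not_lt.1 (key Z hZ Y hYA)) (not_lt.1 (key Y hYA Z hZ)))
        _ = _ := by rw [coinMeasure_cylinder, length_initSeg]
  have hsub : openClass (denseStrings e m s) ⊆ (stage e s \ K) ∪ ⋃ σ, A σ := by
    rintro Z ⟨t, hst, halive, n, hn, hsel⟩
    rw [length_initSeg] at hst hn
    by_cases hZ : Z ∈ K
    · refine Or.inr (Set.mem_iUnion.2 ⟨(initSeg Z t).take n, hZ, ?_, t, hsel⟩)
      rw [take_initSeg _ (by omega)]
      simp [cylinder]
    · exact Or.inl ⟨stage_antitone e hst halive, hZ⟩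
  refine (measure_mono hsub).trans ((measure_union_le _ _).trans (add_le_add le_rfl ?_))
  calc coinMeasure (⋃ σ, A σ) ≤ ∑' σ, coinMeasure (A σ) := measure_iUnion_le _
    _ ≤ ∑' σ : List Bool, (2 : ℝ≥0∞)⁻¹ ^ (encode σ + (m + 1 + 1)) := by
        refine ENNReal.tsum_le_tsum fun σ => (hA σ).trans ?_
        exact pow_le_pow_right_of_le_one' (by simp) (Nat.le_add_left _ _)
    _ ≤ ∑' n : ℕ, (2 : ℝ≥0∞)⁻¹ ^ (n + (m + 1 + 1)) :=
        ENNReal.tsum_comp_le_tsum_of_injective (Encodable.encode_injective (α := List Bool))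
          fun n => (2 : ℝ≥0∞)⁻¹ ^ (n + (m + 1 + 1))
    _ = _ := tsum_two_inv_pow_add _

/-- König's lemma for the approximations to an effectively closed class. -/
lemma exists_mem_of_forall_stage (e : ℕ) (τ : List Bool)
    (h : ∀ s, ∃ π ∈ allStrings s, s ≥ τ.length → τ <+: π ∧ π ∉ enumerated e) :
    ∃ Z ∈ (openClass (ceSet e))ᶜ, Z ∈ cylinder τ := by
  have hne : (⋂ s, stage e s ∩ cylinder τ).Nonempty := by
    refine IsCompact.nonempty_iInter_of_sequence_nonempty_isCompact_isClosed _
      (fun s => Set.inter_subset_inter_left _ (stage_antitone e (Nat.le_succ s))) (fun s => ?_)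
      (((isClosed_stage e 0).inter (isClosed_cylinder τ)).isCompact)
      (fun s => (isClosed_stage e s).inter (isClosed_cylinder τ))
    obtain ⟨π, hπ, hτ⟩ := h (max s τ.length)
    obtain ⟨hτ, hπe⟩ := hτ (le_max_right _ _)
    rw [mem_allStrings] at hπ
    have hpad := initSeg_padded π
    rw [hπ] at hpad
    refine ⟨padded π, stage_antitone e (le_max_left s τ.length) ?_, ?_⟩
    · change initSeg _ _ ∉ _
      rwa [hpad]
    · rw [← initSeg_eq_iff_mem_cylinder rfl, ← take_initSeg _ (le_max_right s τ.length), hpad]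
      exact (List.prefix_iff_eq_take.1 hτ).symm
  obtain ⟨Z, hZ⟩ := hne
  rw [Set.mem_iInter] at hZ
  exact ⟨Z, by rw [← iInter_stage]; exact Set.mem_iInter.2 fun s => (hZ s).1, (hZ 0).2⟩

/-- The path in `K` above `σ` whose prefix of length `L` has least code lies in the class: by
compactness each smaller candidate dies at some finite stage, and there are finitely many
candidates. -/
lemma denseInside_openClass_denseStrings (e m s : ℕ) :
    DenseInside (openClass (ceSet e))ᶜ (openClass (denseStrings e m s)) := by
  classical
  rintro σ ⟨Y, hYσ, hYK⟩
  set L := selectLength m σ with hL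
  have hex : ∃ k, ∃ Z ∈ (openClass (ceSet e))ᶜ, Z ∈ cylinder σ ∧ encode (initSeg Z L) = k :=
    ⟨_, Y, hYK, hYσ, rfl⟩
  obtain ⟨Z, hZK, hZσ, hZk⟩ := Nat.find_spec hex
  have hmin : ∀ τ ∈ allStrings L, σ <+: τ → encode τ < encode (initSeg Z L) →
      ∃ t, L ≤ t ∧ ∀ π ∈ allStrings t, τ <+: π → π ∈ enumerated e := by
    intro τ hτ hστ hlt
    by_contra! hcon
    rw [mem_allStrings] at hτ
    obtain ⟨X, hXK, hXτ⟩ := exists_mem_of_forall_stage e τ fun t => by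
      rcases le_or_gt L t with ht | ht
      · obtain ⟨π, h1, h2, h3⟩ := hcon t ht
        exact ⟨π, h1, fun _ => ⟨h2, h3⟩⟩
      -- Below the length of `τ` nothing is required, so any string of length `t` serves.
      · exact ⟨initSeg Y t, by simp, fun h => by omega⟩
    have hXτ' := (initSeg_eq_iff_mem_cylinder hτ).2 hXτ
    rw [hZk] at hlt
    refine Nat.find_min hex hlt ⟨X, hXK, ?_, by rw [hXτ']⟩
    rw [← initSeg_eq_iff_mem_cylinder rfl, ← take_initSeg X (n := L) (Nat.le_add_right _ _), hXτ']
    exact (List.prefix_iff_eq_take.1 hστ).symm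
  choose! t htL ht using hmin
  obtain ⟨N, hN⟩ : ∃ N, ∀ τ ∈ allStrings L, t τ ≤ N :=
    ⟨((allStrings L).map t).sum, fun τ hτ =>
      List.single_le_sum (fun _ _ => Nat.zero_le _) _ (List.mem_map_of_mem hτ)⟩
  have hZe (n) : initSeg Z n ∉ enumerated e := by
    rw [← iInter_stage] at hZK
    exact Set.mem_iInter.1 hZK n
  have hσL : σ.length ≤ L := Nat.le_add_right _ _
  refine ⟨Z, ⟨hZσ, hZK⟩, max s (max L N), by simp, hZe _, σ.length, ?_, ?_⟩
  · simp; omega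
  · rw [take_initSeg _ (by omega), (initSeg_eq_iff_mem_cylinder rfl).2 hZσ, ← hL]
    refine ⟨by simp, fun τ hτ hστ hlt π hπ hτπ => ?_⟩
    rw [take_initSeg _ (by omega)] at hlt
    rw [length_initSeg, mem_allStrings] at hπ
    have htN := hN τ hτ
    have htL' := htL τ hτ hστ hlt
    have hlen := mem_allStrings.1 hτ
    refine enumerated_of_prefix (List.take_prefix (t τ) π) (ht τ hτ hστ hlt _ ?_ ?_)
    · rw [mem_allStrings, List.length_take]; omega
    · exact List.prefix_take_iff.2 ⟨hτπ, by omega⟩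

/-! ### Finding a good stage from the halting problem -/

lemma measureReal_stage (e s : ℕ) : coinMeasure.real (stage e s) = aliveCount e s / 2 ^ s := by
  simp [Measure.real, coinMeasure_stage, div_eq_mul_inv]

lemma aliveCount_mul_lt_iff (e s k r : ℕ) :
    aliveCount e s * k < r * 2 ^ s ↔ coinMeasure.real (stage e s) * k < r := by
  rw [measureReal_stage, div_mul_eq_mul_div, div_lt_iff₀ (by positivity)]
  exact_mod_cast Iff.rfl

lemma primrec_list_sum : Primrec (List.sum : List ℕ → ℕ) :=
  (Primrec.list_foldr Primrec.id (Primrec.const 0)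
    (Primrec.nat_add.comp (Primrec.fst.comp Primrec.snd) (Primrec.snd.comp Primrec.snd)).to₂).of_eq
      fun l => by simp [List.sum]

/-- The stage `s` settles the string `l` of answers to the queries `q x r` about precision
`2 ^ (x + 1)`: whenever `l` asserts that the measure of some stage is below `(r + 1) / 2 ^ (x + 1)`,
the measure of stage `s` is. -/
def Settles (e : ℕ) (q : ℕ × ℕ → ℕ) (x : ℕ) (l : List Bool) (s : ℕ) : Prop :=
  ∀ r < 2 ^ (x + 1) + 1, l.getD (q (x, r)) false = true →
    aliveCount e s * 2 ^ (x + 1) < (r + 1) * 2 ^ s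

lemma primrec_settles (e : ℕ) {q : ℕ × ℕ → ℕ} (hq : Primrec q) :
    PrimrecPred fun x : (ℕ × List Bool) × ℕ => Settles e q x.1.1 x.1.2 x.2 := by
  have hpow : Primrec fun x : (ℕ × List Bool) × ℕ => 2 ^ (x.1.1 + 1) :=
    primrec_two_pow.comp (Primrec.succ.comp (Primrec.fst.comp Primrec.fst))
  refine primrecPred_forall_lt (Primrec.succ.comp hpow) ?_
  refine primrecPred_imp (Primrec.eq.comp ((Primrec.list_getD false).comp
    ((Primrec.snd.comp Primrec.fst).comp Primrec.fst)
    (hq.comp (((Primrec.fst.comp Primrec.fst).comp Primrec.fst).pair Primrec.snd)))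
    (Primrec.const true)) ?_
  exact Primrec.nat_lt.comp (Primrec.nat_mul.comp
    (primrec_aliveCount.comp (Primrec.const e) (Primrec.snd.comp Primrec.fst))
    (hpow.comp Primrec.fst)) (Primrec.nat_mul.comp (Primrec.succ.comp Primrec.snd)
      (primrec_two_pow.comp (Primrec.snd.comp Primrec.fst)))

lemma tendsto_measureReal_stage (e : ℕ) :
    Filter.Tendsto (fun s => coinMeasure.real (stage e s)) Filter.atTop
      (nhds (coinMeasure.real (openClass (ceSet e))ᶜ)) := by
  rw [← iInter_stage]
  exact (ENNReal.continuousAt_toReal (measure_ne_top _ _)).tendsto.comp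
    (tendsto_measure_iInter_atTop (fun s => (isClosed_stage e s).measurableSet.nullMeasurableSet)
      (stage_antitone e) ⟨0, measure_ne_top _ _⟩)

/-- A stage approximating the measure of an effectively closed class from above can be found
from `∅'` with computably bounded use. -/
lemma exists_wttReducible_of_stage (e : ℕ) {g : ℕ × ℕ → ℕ} (hg : Primrec g) :
    ∃ f : ℕ → ℕ, WttReducible f halting ∧ ∀ x, ∃ s, f x = g (x, s) ∧
      coinMeasure (stage e s \ (openClass (ceSet e))ᶜ) ≤ 2⁻¹ ^ (x + 1) := by
  classical
  have hp : PrimrecPred fun a : (ℕ × ℕ) × ℕ =>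
      aliveCount e a.2 * 2 ^ (a.1.1 + 1) < (a.1.2 + 1) * 2 ^ a.2 :=
    Primrec.nat_lt.comp (Primrec.nat_mul.comp (primrec_aliveCount.comp (Primrec.const e) Primrec.snd)
      (primrec_two_pow.comp (Primrec.succ.comp (Primrec.fst.comp Primrec.fst))))
      (Primrec.nat_mul.comp (Primrec.succ.comp (Primrec.snd.comp Primrec.fst))
        (primrec_two_pow.comp Primrec.snd))
  obtain ⟨q, hq, hqs⟩ := exists_halting_query (rePred_exists (α := ℕ × ℕ)
    (p := fun a s => aliveCount e s * 2 ^ (a.1 + 1) < (a.2 + 1) * 2 ^ s) hp)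
  -- The sum dominates every query at precision `x`, and adding one to each term puts the queried
  -- position strictly inside the oracle prefix.
  let h (x : ℕ) : ℕ := ((List.range (2 ^ (x + 1) + 1)).map fun r => q (x, r) + 1).sum
  have hh : Primrec h := primrec_list_sum.comp (Primrec.list_map
    (Primrec.list_range.comp (Primrec.succ.comp (primrec_two_pow.comp Primrec.succ)))
    (Primrec.succ.comp (hq.comp (Primrec.fst.pair Primrec.snd))).to₂)
  have hlt (x r) (hr : r < 2 ^ (x + 1) + 1) : q (x, r) < h x :=
    List.single_le_sum (fun _ _ => Nat.zero_le _) _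
      (List.mem_map_of_mem (f := fun r => q (x, r) + 1) (List.mem_range.2 hr))
  let μ (s : ℕ) : ℝ := coinMeasure.real (stage e s)
  have hμ : Antitone μ := fun s t hst => measureReal_mono (stage_antitone e hst)
  have key (x s r : ℕ) : aliveCount e s * 2 ^ (x + 1) < (r + 1) * 2 ^ s ↔
      μ s * 2 ^ (x + 1) < r + 1 := by
    have := aliveCount_mul_lt_iff e s (2 ^ (x + 1)) (r + 1)
    push_cast at this
    exact this
  have hsettle (x s) : Settles e q x (initSeg halting (h x)) s ↔
      ∀ r : ℕ, r < 2 ^ (x + 1) + 1 → (∃ t, μ t * 2 ^ (x + 1) < r + 1) → μ s * 2 ^ (x + 1) < r + 1 := by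
    refine forall₂_congr fun r hr => ?_
    have : (initSeg halting (h x)).getD (q (x, r)) false = halting (q (x, r)) := by
      simp [initSeg, hlt x r hr]
    rw [this, hqs, key]
    simp only [key]
  have hex (x) : ∃ s, Settles e q x (initSeg halting (h x)) s := by
    have : ∀ r : ℕ, ∃ s, (∃ t, μ t * 2 ^ (x + 1) < (r : ℝ) + 1) → μ s * 2 ^ (x + 1) < (r : ℝ) + 1 := by
      intro r
      by_cases hr : ∃ t, μ t * 2 ^ (x + 1) < (r : ℝ) + 1
      · obtain ⟨t, ht⟩ := hr
        exact ⟨t, fun _ => ht⟩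
      · exact ⟨0, fun h => absurd h hr⟩
    choose s hs using this
    refine ⟨(Finset.range (2 ^ (x + 1) + 1)).sup s, (hsettle x _).2 fun r hr ht => ?_⟩
    refine lt_of_le_of_lt (mul_le_mul_of_nonneg_right (hμ ?_) (by positivity)) (hs r ht)
    exact Finset.le_sup (Finset.mem_range.2 hr)
  -- Taking the least settling stage matches the unbounded search of the reduction.
  let S (x : ℕ) : ℕ := Nat.find (hex x)
  refine ⟨fun x => g (x, S x), ⟨h, hh.to_comp, fun y =>
    (Nat.rfind fun s => Part.some (decide (Settles e q y.1 y.2 s))).map fun s => g (y.1, s),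
    ?_, fun x => ?_⟩, fun x => ⟨S x, rfl, ?_⟩⟩
  · exact Partrec.map (Partrec.rfind (primrec_settles e hq).decide.to_comp.partrec)
      (hg.comp ((Primrec.fst.comp Primrec.fst).pair Primrec.snd)).to_comp.to₂
  · refine Part.mem_map _ (Nat.mem_rfind.2 ⟨?_, fun {m} hm => ?_⟩)
    · simpa using Nat.find_spec (hex x)
    · simpa using Nat.find_min (hex x) hm
  · set K := (openClass (ceSet e))ᶜ with hK
    set a := coinMeasure.real K with ha
    have hSx := (hsettle x (S x)).1 (Nat.find_spec (hex x))
    have hpos : (0 : ℝ) < 2 ^ (x + 1) := by positivity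
    have ha0 : 0 ≤ a * 2 ^ (x + 1) := mul_nonneg measureReal_nonneg hpos.le
    -- This is the decisive query. Since `a ≤ 1`, it is among those asked, and its answer is yes;
    -- settling it brings stage `S x` within `2⁻¹ ^ (x + 1)` of `K`.
    have hr : ⌊a * 2 ^ (x + 1)⌋₊ < 2 ^ (x + 1) + 1 := by
      rw [Nat.floor_lt ha0]
      push_cast
      have : a ≤ 1 := measureReal_le_one
      nlinarith
    have hfl : a < (⌊a * 2 ^ (x + 1)⌋₊ + 1) / 2 ^ (x + 1) := by
      rw [lt_div_iff₀ hpos]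
      exact Nat.lt_floor_add_one _
    obtain ⟨t, ht⟩ := ((tendsto_measureReal_stage e).eventually_lt_const hfl).exists
    rw [lt_div_iff₀ hpos] at ht
    have h1 := hSx _ hr ⟨t, ht⟩
    have h2 := Nat.floor_le ha0
    have hKS : K ⊆ stage e (S x) := by
      rw [hK, ← iInter_stage]
      exact Set.iInter_subset _ _
    have hreal : coinMeasure.real (stage e (S x) \ K) ≤ (2⁻¹ : ℝ) ^ (x + 1) := by
      rw [measureReal_sdiff hKS (isOpen_openClass _).isClosed_compl.measurableSet, inv_pow,
        ← one_div, le_div_iff₀ hpos, sub_mul]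
      linarith
    rw [← ENNReal.ofReal_toReal (measure_ne_top coinMeasure (stage e (S x) \ K))]
    refine (ENNReal.ofReal_le_ofReal hreal).trans ?_
    rw [ENNReal.ofReal_pow (by norm_num), ENNReal.ofReal_inv_of_pos (by norm_num)]
    simp

/-- Every effectively closed class has a Demuth test whose components are dense in it. -/
theorem exists_demuthTest_dense (e : ℕ) :
    ∃ S : ℕ → Set Cantor, IsDemuthTest S ∧ (∀ i, IsOpen (S i)) ∧
      ∀ i, DenseInside (openClass (ceSet e))ᶜ (S i) := by
  obtain ⟨g, hg, hgs⟩ := exists_ceSet_index (R := fun a : ℕ × ℕ => denseStrings e a.1 a.2)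
    (primrec_denseStrings e).computablePred.to_re
  obtain ⟨f, hf, hfs⟩ := exists_wttReducible_of_stage e hg
  choose s hs hms using hfs
  refine ⟨fun m => openClass (ceSet (f m)), ⟨fun m => ?_, f, hf, fun _ => rfl⟩,
    fun _ => isOpen_openClass _, fun m => ?_⟩
  · simp only [hs, hgs]
    refine (measure_openClass_denseStrings_le e m (s m)).trans ?_
    refine (add_le_add_left (hms m) _).trans ?_
    -- The excess of the stage and the selected cylinders each account for half of `2⁻¹ ^ m`.
    rw [pow_succ, ← mul_add, ENNReal.inv_two_add_inv_two, mul_one]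
  · simp only [hs, hgs]
    exact denseInside_openClass_denseStrings e m (s m)

/-! ### Recursive trees and restriction of conditions -/

lemma IsRecursiveTree.inter {A B : Set (List Bool)} (hA : IsRecursiveTree A)
    (hB : IsRecursiveTree B) : IsRecursiveTree (A ∩ B) := by
  refine ⟨?_, fun σ τ h hτ => ⟨hA.2 σ τ h hτ.1, hB.2 σ τ h hτ.2⟩⟩
  obtain ⟨f, hf, hfA⟩ := ComputablePred.computable_iff.1 hA.1
  obtain ⟨g, hg, hgB⟩ := ComputablePred.computable_iff.1 hB.1
  refine ComputablePred.computable_iff.2 ⟨fun σ => f σ && g σ,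
    (Primrec.and.to_comp.comp hf hg), funext fun σ => ?_⟩
  have h1 := congrFun hfA σ
  have h2 := congrFun hgB σ
  simp only [Set.mem_inter_iff, Bool.and_eq_true, h1, h2]

lemma paths_inter (A B : Set (List Bool)) : paths (A ∩ B) = paths A ∩ paths B := by
  ext Z; simp [paths, forall_and]

lemma paths_compl (W : Set (List Bool)) : paths Wᶜ = (openClass W)ᶜ := by
  ext Z; simp [paths, openClass]

lemma isClosed_paths (T : Set (List Bool)) : IsClosed (paths T) := by
  rw [← compl_compl T, paths_compl]
  exact (isOpen_openClass _).isClosed_compl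

lemma isRecursiveTree_compl_enumerated (e : ℕ) : IsRecursiveTree (enumerated e)ᶜ :=
  ⟨(primrec_enumerated.comp (Primrec.const e) Primrec.id).not.computablePred,
    fun _ _ h hτ hσ => hτ (enumerated_of_prefix h hσ)⟩

lemma paths_compl_enumerated (e : ℕ) : paths (enumerated e)ᶜ = (openClass (ceSet e))ᶜ := by
  rw [paths_compl, openClass_ceSet]

lemma isRecursiveTree_comparable (σ : List Bool) :
    IsRecursiveTree {τ | σ <+: τ ∨ τ <+: σ} := by
  refine ⟨((primrecRel_prefix.comp (Primrec.const σ) Primrec.id).or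
    (primrecRel_prefix.comp Primrec.id (Primrec.const σ))).computablePred, ?_⟩
  rintro τ ρ h (hρ | hρ)
  · exact List.prefix_or_prefix_of_prefix hρ h
  · exact Or.inr (h.trans hρ)

lemma paths_comparable (σ : List Bool) : paths {τ | σ <+: τ ∨ τ <+: σ} = cylinder σ := by
  ext Z
  constructor
  · intro hZ
    rcases hZ σ.length with h | h
    · exact (h.eq_of_length (by simp)).symm
    · exact h.eq_of_length (by simp)
  · intro hZ n
    rw [← (initSeg_eq_iff_mem_cylinder rfl).2 hZ]
    rcases le_total n σ.length with h | h
    · exact Or.inr (initSeg_prefix Z h)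
    · exact Or.inl (initSeg_prefix Z h)

lemma IsRecursiveTree.exists_index {T : Set (List Bool)} (hT : IsRecursiveTree T) :
    ∃ e, paths T = (openClass (ceSet e))ᶜ := by
  have hc : Computable fun x : Unit × List Bool => x.2 := Computable.snd
  have : REPred fun x : Unit × List Bool => x.2 ∈ Tᶜ :=
    Partrec.comp (f := fun σ => Part.assert (σ ∈ Tᶜ) fun _ => Part.some ()) hT.1.not.to_re hc
  obtain ⟨g, -, hg⟩ := exists_ceSet_index (R := fun _ : Unit => Tᶜ) this
  exact ⟨g (), by rw [hg, ← paths_compl, compl_compl]⟩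

/-- The subtree of a condition obtained by intersecting with a recursive tree. -/
def MLTree.restrict (P : MLTree) (B : Set (List Bool)) (hB : IsRecursiveTree B)
    (h : (paths P.tree ∩ paths B).Nonempty) : MLTree where
  tree := P.tree ∩ B
  recursive := P.recursive.inter hB
  nonempty := by rwa [paths_inter]
  random Z hZ := by
    rw [paths_inter] at hZ
    exact P.random Z hZ.1

lemma MLTree.restrict_le (P : MLTree) (B : Set (List Bool)) (hB : IsRecursiveTree B)
    (h : (paths P.tree ∩ paths B).Nonempty) : P.restrict B hB h ≤ P :=
  Set.inter_subset_left

lemma MLTree.paths_restrict (P : MLTree) (B : Set (List Bool)) (hB : IsRecursiveTree B)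
    (h : (paths P.tree ∩ paths B).Nonempty) :
    paths (P.restrict B hB h).tree = paths P.tree ∩ paths B :=
  paths_inter _ _

lemma MLTree.paths_mono {P Q : MLTree} (h : P ≤ Q) : paths P.tree ⊆ paths Q.tree :=
  fun _ hZ n => h (hZ n)

/-! ### Conditions have positive measure -/

/-- A Martin-Löf random real lies in no effectively closed null class. -/
lemma MLRandom.measure_ne_zero {Z : Cantor} (hZ : MLRandom Z) {e : ℕ}
    (hZe : Z ∈ (openClass (ceSet e))ᶜ) : coinMeasure (openClass (ceSet e))ᶜ ≠ 0 := by
  intro h0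
  let R (m : ℕ) : Set (List Bool) :=
    {ρ | ρ ∉ enumerated e ∧ aliveCount e ρ.length * 2 ^ m < 1 * 2 ^ ρ.length}
  have hR : PrimrecPred fun x : ℕ × List Bool => x.2 ∈ R x.1 := by
    have hl : Primrec fun x : ℕ × List Bool => x.2.length := Primrec.list_length.comp Primrec.snd
    exact (primrec_enumerated.comp (Primrec.const e) Primrec.snd).not.and
      (Primrec.nat_lt.comp (Primrec.nat_mul.comp (primrec_aliveCount.comp (Primrec.const e) hl)
        (primrec_two_pow.comp Primrec.fst))
        (Primrec.nat_mul.comp (Primrec.const 1) (primrec_two_pow.comp hl)))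
  obtain ⟨g, hg, hgR⟩ := exists_ceSet_index hR.computablePred.to_re
  have key (m s : ℕ) : aliveCount e s * 2 ^ m < 1 * 2 ^ s ↔
      coinMeasure.real (stage e s) * 2 ^ m < 1 := by
    simpa using aliveCount_mul_lt_iff e s (2 ^ m) 1
  have htest (m : ℕ) : coinMeasure (openClass (ceSet (g m))) ≤ 2⁻¹ ^ m := by
    rw [hgR]
    by_cases hex : ∃ s, aliveCount e s * 2 ^ m < 1 * 2 ^ s
    · have hsub : openClass (R m) ⊆ stage e (Nat.find hex) := by
        rintro Y ⟨s, hs, hcount⟩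
        rw [length_initSeg] at hcount
        exact stage_antitone e (Nat.find_min' hex hcount) hs
      refine (measure_mono hsub).trans ?_
      have h1 := (key m _).1 (Nat.find_spec hex)
      rw [← ENNReal.ofReal_toReal (measure_ne_top coinMeasure (stage e (Nat.find hex)))]
      have h2 : (coinMeasure (stage e (Nat.find hex))).toReal ≤ (2⁻¹ : ℝ) ^ m := by
        rw [inv_pow, ← one_div, le_div_iff₀ (by positivity)]
        exact h1.le
      refine (ENNReal.ofReal_le_ofReal h2).trans ?_
      rw [ENNReal.ofReal_pow (by norm_num), ENNReal.ofReal_inv_of_pos (by norm_num)]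
      simp
    · have : openClass (R m) = ∅ := by
        refine Set.eq_empty_of_forall_notMem ?_
        rintro Y ⟨s, -, hcount⟩
        exact hex ⟨_, hcount⟩
      simp [this]
  obtain ⟨m, hm⟩ := hZ _ ⟨htest, g, hg.to_comp, fun _ => rfl⟩
  refine hm ?_
  have ht := tendsto_measureReal_stage e
  rw [Measure.real, h0, ENNReal.toReal_zero] at ht
  obtain ⟨s, hs⟩ := (ht.eventually_lt_const (show (0 : ℝ) < 1 / 2 ^ m by positivity)).exists
  rw [lt_div_iff₀ (by positivity)] at hs
  rw [← iInter_stage] at hZe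
  rw [hgR]
  exact ⟨s, Set.mem_iInter.1 hZe s, by rw [length_initSeg]; exact (key m s).2 hs⟩

lemma MLTree.measure_paths_ne_zero (P : MLTree) : coinMeasure (paths P.tree) ≠ 0 := by
  obtain ⟨e, he⟩ := P.recursive.exists_index
  obtain ⟨Z, hZ⟩ := P.nonempty
  have hr := P.random Z hZ
  rw [he] at hZ ⊢
  exact hr.measure_ne_zero hZ

/-! ### Existence of a condition -/

/-- The condition that the part of `openClass (ceSet w)` enumerated by stage `s` has measure at
most `2⁻ᵏ`. -/
def SmallAt (w s k : ℕ) : Prop := 2 ^ s * 2 ^ k ≤ 2 ^ s + aliveCount w s * 2 ^ k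

lemma smallAt_iff {w s k : ℕ} : SmallAt w s k ↔ coinMeasure (stage w s)ᶜ ≤ 2⁻¹ ^ k := by
  have hs : (0 : ℝ) < 2 ^ s := by positivity
  have hk : (0 : ℝ) < 2 ^ k := by positivity
  have h1 : coinMeasure (stage w s)ᶜ ≤ 2⁻¹ ^ k ↔
      1 - (aliveCount w s : ℝ) / 2 ^ s ≤ (2 ^ k)⁻¹ := by
    rw [← measureReal_stage, ← probReal_compl_eq_one_sub (isClosed_stage w s).measurableSet,
      Measure.real, ← ENNReal.toReal_le_toReal (measure_ne_top _ _) (by simp)]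
    simp
  rw [h1, SmallAt, ← one_div, le_div_iff₀ hk, one_sub_div hs.ne', div_mul_eq_mul_div,
    div_le_iff₀ hs, sub_mul, sub_le_iff_le_add, one_mul]
  exact_mod_cast Iff.rfl

/-- Strings generating an open class of measure at most `1/2` that contains every real that is not
Martin-Löf random: the `c`-th partial computable function contributes the part of its component
`c + 2` that is enumerated while the measure does not exceed `2 ^ -(c + 2)`. -/
def nonrandomStrings : Set (List Bool) :=
  {σ | ∃ c < σ.length,
    ∃ w ∈ (Code.evaln σ.length (Denumerable.ofNat Code c) (c + 2)).toList,
      σ ∈ enumerated w ∧ SmallAt w σ.length (c + 2)}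

lemma primrec_nonrandomStrings : PrimrecPred fun σ => σ ∈ nonrandomStrings := by
  refine primrecPred_exists_lt Primrec.list_length ?_
  have hc2 : Primrec fun x : List Bool × ℕ => x.2 + 2 :=
    Primrec.nat_add.comp Primrec.snd (Primrec.const 2)
  refine primrecPred_exists_mem (Primrec.optionToList.comp (Code.primrec_evaln.comp
    (((Primrec.list_length.comp Primrec.fst).pair ((Primrec.ofNat Code).comp Primrec.snd)).pair
      hc2))) ?_
  refine (primrec_enumerated.comp Primrec.snd (Primrec.fst.comp Primrec.fst)).and ?_
  have hs : Primrec fun x : (List Bool × ℕ) × ℕ => x.1.1.length :=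
    Primrec.list_length.comp (Primrec.fst.comp Primrec.fst)
  have hk : Primrec fun x : (List Bool × ℕ) × ℕ => 2 ^ (x.1.2 + 2) :=
    primrec_two_pow.comp (hc2.comp Primrec.fst)
  exact Primrec.nat_le.comp (Primrec.nat_mul.comp (primrec_two_pow.comp hs) hk)
    (Primrec.nat_add.comp (primrec_two_pow.comp hs)
      (Primrec.nat_mul.comp (primrec_aliveCount.comp Primrec.snd hs) hk))

lemma measure_openClass_nonrandomStrings_le :
    coinMeasure (openClass nonrandomStrings) ≤ 2⁻¹ := by
  let A (w k s : ℕ) : Set Cantor := {Z | Z ∉ stage w s ∧ SmallAt w s k}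
  have hA (w k : ℕ) : coinMeasure (⋃ s, A w k s) ≤ 2⁻¹ ^ k := by
    -- The enumerated part grows until the bound is exceeded, after which `A w k` is empty; so any
    -- two stages are comparable and the union has the measure of a supremum.
    have hsub {s t : ℕ} (h : s ≤ t) : A w k s ⊆ A w k t ∨ A w k t ⊆ A w k s := by
      by_cases ht : SmallAt w t k
      · exact Or.inl fun Z hZ => ⟨fun hZt => hZ.1 (stage_antitone w h hZt), ht⟩
      · exact Or.inr fun Z hZ => absurd hZ.2 ht
    have hdir : Directed (· ⊆ ·) (A w k) := by
      intro s t
      have : A w k s ⊆ A w k t ∨ A w k t ⊆ A w k s :=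
        (le_total s t).elim hsub fun h => (hsub h).symm
      rcases this with h | h
      · exact ⟨t, h, subset_rfl⟩
      · exact ⟨s, subset_rfl, h⟩
    rw [hdir.measure_iUnion]
    refine iSup_le fun s => ?_
    by_cases hs : SmallAt w s k
    · exact (measure_mono fun Z hZ => hZ.1).trans (smallAt_iff.1 hs)
    · have : A w k s = ∅ := Set.eq_empty_of_forall_notMem fun Z hZ => hs hZ.2
      simp [this]
  let U (c : ℕ) : Set Cantor :=
    {Z | ∃ w ∈ (Denumerable.ofNat Code c).eval (c + 2), Z ∈ ⋃ s, A w (c + 2) s}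
  have hU (c : ℕ) : coinMeasure (U c) ≤ 2⁻¹ ^ (c + 2) := by
    by_cases hd : ((Denumerable.ofNat Code c).eval (c + 2)).Dom
    · obtain ⟨w, hw⟩ := Part.dom_iff_mem.1 hd
      refine (measure_mono ?_).trans (hA w (c + 2))
      rintro Z ⟨w', hw', hZ⟩
      rwa [Part.mem_unique hw' hw] at hZ
    · have : U c = ∅ := Set.eq_empty_of_forall_notMem fun Z hZ =>
        hd (Part.dom_iff_mem.2 ⟨hZ.choose, hZ.choose_spec.1⟩)
      simp [this]
  have hsub : openClass nonrandomStrings ⊆ ⋃ c, U c := by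
    rintro Z ⟨s, c, -, w, hw, hZw, hsmall⟩
    rw [length_initSeg] at hw hsmall
    refine Set.mem_iUnion.2 ⟨c, w, Code.evaln_sound (Option.mem_toList.1 hw),
      Set.mem_iUnion.2 ⟨s, fun h => h hZw, hsmall⟩⟩
  calc coinMeasure (openClass nonrandomStrings) ≤ ∑' c, coinMeasure (U c) :=
        (measure_mono hsub).trans (measure_iUnion_le _)
    _ ≤ ∑' c : ℕ, 2⁻¹ ^ (c + (1 + 1)) := ENNReal.tsum_le_tsum hU
    _ = 2⁻¹ := by rw [tsum_two_inv_pow_add, pow_one]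

/-- If a test captures `Z` and `c` codes its index function, then component `c + 2` also captures
`Z`. Its measure bound holds at every stage, so its contribution is never cut off. -/
lemma mlRandom_of_notMem {Z : Cantor} (hZ : Z ∉ openClass nonrandomStrings) : MLRandom Z := by
  rintro S ⟨hS, f, hf, hSf⟩
  by_contra! hcon
  obtain ⟨code, hcode⟩ := Code.exists_code.1 (Partrec.nat_iff.1 hf.partrec)
  set c := encode code with hc
  have hcc : Denumerable.ofNat Code c = code := Denumerable.ofNat_encode code
  set w := f (c + 2) with hw
  have hwm : w ∈ code.eval (c + 2) := by rw [hcode]; exact Part.mem_some _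
  obtain ⟨k, hk⟩ := Code.evaln_complete.1 hwm
  have hZw := hcon (c + 2)
  rw [hSf, openClass_ceSet] at hZw
  obtain ⟨n, hn⟩ := hZw
  -- Long enough for the component to have caught `Z`, for the index computation to have halted, and
  -- for `c` to be below the string length.
  set s := max n (max k (c + 1)) with hs
  refine hZ ⟨s, c, by rw [length_initSeg]; omega, w, ?_, ?_, ?_⟩
  · rw [length_initSeg, Option.mem_toList, hcc]
    exact Code.evaln_mono (by omega) hk
  · exact enumerated_of_prefix (initSeg_prefix Z (by omega)) hn
  · rw [smallAt_iff, length_initSeg]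
    refine le_trans (measure_mono ?_) (hS (c + 2))
    rw [hSf, Set.compl_subset_comm, ← iInter_stage]
    exact Set.iInter_subset _ _

theorem nonempty_mlTree : Nonempty MLTree := by
  have hc : Computable fun x : Unit × List Bool => x.2 := Computable.snd
  have : PrimrecPred fun x : Unit × List Bool => x.2 ∈ nonrandomStrings :=
    primrec_nonrandomStrings.comp Primrec.snd
  obtain ⟨g, -, hg⟩ := exists_ceSet_index (R := fun _ : Unit => nonrandomStrings)
    this.computablePred.to_re
  have hpaths : paths (enumerated (g ()))ᶜ = (openClass nonrandomStrings)ᶜ := by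
    rw [paths_compl_enumerated, hg]
  refine ⟨⟨(enumerated (g ()))ᶜ, isRecursiveTree_compl_enumerated _, ?_, fun Z hZ => ?_⟩⟩
  · rw [hpaths, Set.nonempty_compl]
    intro h
    have := measure_openClass_nonrandomStrings_le
    rw [h, measure_univ] at this
    simp at this
  · rw [hpaths] at hZ
    exact mlRandom_of_notMem hZ

/-! ### Dense sets of conditions -/

/-- A recursive tree has a Demuth test whose intersection is a `Gδ` set that is dense in the class
of paths of the tree. -/
lemma exists_demuthTest_iInter_dense {T : Set (List Bool)} (hT : IsRecursiveTree T) :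
    ∃ S : ℕ → Set Cantor, IsDemuthTest S ∧ IsGδ (⋂ i, S i) ∧ DenseInside (paths T) (⋂ i, S i) := by
  obtain ⟨e, he⟩ := hT.exists_index
  obtain ⟨S, hS, hopen, hd⟩ := exists_demuthTest_dense e
  rw [← he] at hd
  exact ⟨S, hS, IsGδ.iInter fun i => (hopen i).isGδ,
    denseInside_iInter (isClosed_paths T) (fun i => (hopen i).isGδ) hd⟩

/-- Were `G` dense in the paths of `P`, Baire would give a common point of `G` and a whole Demuth
test. So some cylinder meets the paths but misses `G` there, and restricting `P` to it gives the
required extension. -/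
theorem forcingDense_avoid_of_isGδ {G : Set Cantor} (hG : IsGδ G)
    (hGr : ∀ Z ∈ G, WeaklyDemuthRandom Z) :
    ForcingDense {P : MLTree | paths P.tree ∩ G = ∅} := by
  intro P
  obtain ⟨S, hS, hSδ, hSd⟩ := exists_demuthTest_iInter_dense P.recursive
  have hnot : ¬ DenseInside (paths P.tree) G := by
    intro hGd
    have hd := denseInside_iInter (ι := Bool) (isClosed_paths P.tree)
      (A := fun b => cond b G (⋂ i, S i)) (Bool.forall_bool.2 ⟨hSδ, hG⟩)
      (Bool.forall_bool.2 ⟨hSd, hGd⟩)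
    obtain ⟨Z, hZ⟩ := P.nonempty
    obtain ⟨Y, -, hY⟩ := hd [] ⟨Z, rfl, hZ⟩
    rw [Set.mem_iInter] at hY
    obtain ⟨m, hm⟩ := hGr Y (hY true) S hS
    exact hm (Set.mem_iInter.1 (hY false) m)
  simp only [DenseInside, not_forall] at hnot
  obtain ⟨σ, hσ, hempty⟩ := hnot
  rw [← paths_comparable, Set.inter_comm] at hσ
  refine ⟨P.restrict _ (isRecursiveTree_comparable σ) hσ, ?_, P.restrict_le _ _ _⟩
  rw [Set.mem_ofPred_eq, P.paths_restrict, paths_comparable, Set.inter_comm (paths P.tree)]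
  exact Set.not_nonempty_iff_eq_empty.1 hempty

/-- A class of positive measure is not contained in a null set, so some path misses a single
component, whose complement is effectively closed. Only the one index `f m` enters the new tree, so
`f` may have any complexity, as Demuth tests require. -/
lemma forcingDense_avoid_null (f : ℕ → ℕ) (hf : coinMeasure (⋂ m, openClass (ceSet (f m))) = 0) :
    ForcingDense {P : MLTree | paths P.tree ∩ ⋂ m, openClass (ceSet (f m)) = ∅} := by
  intro P
  have : ¬ paths P.tree ⊆ ⋂ m, openClass (ceSet (f m)) := fun h =>
    P.measure_paths_ne_zero (measure_mono_null h hf)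
  obtain ⟨Z, hZP, hZ⟩ := Set.not_subset.1 this
  rw [Set.mem_iInter, not_forall] at hZ
  obtain ⟨m, hm⟩ := hZ
  have hne : (paths P.tree ∩ paths (enumerated (f m))ᶜ).Nonempty :=
    ⟨Z, hZP, by rwa [paths_compl_enumerated]⟩
  refine ⟨P.restrict _ (isRecursiveTree_compl_enumerated (f m)) hne, ?_, P.restrict_le _ _ _⟩
  rw [Set.mem_ofPred_eq, P.paths_restrict, paths_compl_enumerated]
  refine Set.eq_empty_of_forall_notMem ?_
  rintro Y ⟨⟨-, hY⟩, hY'⟩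
  exact hY (Set.mem_iInter.1 hY' m)

/-! ### Countably many tests -/

open Classical in
/-- The total function that agrees with the partial function of `c` where this is defined. -/
noncomputable def totalEval (c : Code) (n : ℕ) : ℕ :=
  if h : (c.eval n).Dom then (c.eval n).get h else 0

lemma totalEval_eq {c : Code} {n x : ℕ} (h : x ∈ c.eval n) : totalEval c n = x := by
  have hd := Part.dom_iff_mem.2 ⟨x, h⟩
  rw [totalEval, dif_pos hd]
  exact Part.get_eq_of_mem h hd

lemma exists_totalEval_eq {f : ℕ → ℕ} (hf : Computable f) : ∃ c, totalEval c = f := by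
  obtain ⟨c, hc⟩ := Code.exists_code.1 (Partrec.nat_iff.1 hf.partrec)
  exact ⟨c, funext fun n => totalEval_eq (by rw [hc]; exact Part.mem_some _)⟩

lemma countable_computable : {f : ℕ → ℕ | Computable f}.Countable :=
  (Set.countable_range totalEval).mono fun _ hf => exists_totalEval_eq hf

/-- A reduction is determined by two programs, one for the use bound and one for the procedure. -/
lemma countable_wttReducible (A : Cantor) : {f : ℕ → ℕ | WttReducible f A}.Countable := by
  refine (Set.countable_range fun (p : Code × Code) (x : ℕ) =>
    totalEval p.2 (encode (x, initSeg A (totalEval p.1 x)))).mono ?_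
  rintro f ⟨h, hh, ψ, hψ, hf⟩
  obtain ⟨c, rfl⟩ := exists_totalEval_eq hh
  obtain ⟨d, hd⟩ := Code.exists_code.1 hψ
  refine ⟨(c, d), funext fun x => totalEval_eq ?_⟩
  rw [hd]
  beta_reduce
  rw [Encodable.encodek]
  simpa using hf x

lemma IsDemuthTest.measure_iInter {S : ℕ → Set Cantor} (hS : IsDemuthTest S) :
    coinMeasure (⋂ m, S m) = 0 := by
  have ht : Filter.Tendsto (fun m : ℕ => (2 : ℝ≥0∞)⁻¹ ^ m) Filter.atTop (nhds 0) :=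
    ENNReal.tendsto_pow_atTop_nhds_zero_of_lt_one (by simp)
  exact le_antisymm (ge_of_tendsto' ht fun m =>
    (measure_mono (Set.iInter_subset _ m)).trans (hS.1 m)) zero_le

/-! ### Generic reals -/

lemma GenericFor.notMem {𝒟 : Set (Set MLTree)} {x : Cantor} (hx : GenericFor 𝒟 x) {H : Set Cantor}
    (hmem : {P : MLTree | paths P.tree ∩ H = ∅} ∈ 𝒟)
    (hd : ForcingDense {P : MLTree | paths P.tree ∩ H = ∅}) : x ∉ H := by
  obtain ⟨F, hF, hFx⟩ := hx
  obtain ⟨P, hPF, hP⟩ := hF _ hmem hd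
  have hxP : x ∈ paths P.tree := by
    have : x ∈ ⋂ P ∈ F, paths P.tree := hFx ▸ rfl
    exact Set.mem_iInter₂.1 this P hPF
  intro hxH
  exact (Set.eq_empty_iff_forall_notMem.1 hP) x ⟨hxP, hxH⟩

theorem sufficientlyGeneric_random :
    SufficientlyGenericAre fun x => WeaklyTwoRandom x ∧ WeaklyDemuthRandom x := by
  refine ⟨(fun f : ℕ → ℕ => {P : MLTree | paths P.tree ∩ ⋂ m, openClass (ceSet (f m)) = ∅}) ''
    ({f | Computable f} ∪ {f | WttReducible f halting}),
    (countable_computable.union (countable_wttReducible halting)).image _,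
    fun x hx => ⟨fun f hf h0 => ?_, fun S hS => ?_⟩⟩
  · exact hx.notMem ⟨f, Or.inl hf, rfl⟩ (forcingDense_avoid_null f h0)
  · have h0 := hS.measure_iInter
    obtain ⟨-, f, hf, hSf⟩ := hS
    simp only [hSf] at h0 ⊢
    have := hx.notMem ⟨f, Or.inr hf, rfl⟩ (forcingDense_avoid_null f h0)
    rwa [Set.mem_iInter, not_forall] at this

theorem sufficientlyGeneric_notMem {H : Set Cantor} (hH : BoldSigma03 H)
    (hHr : ∀ Z ∈ H, WeaklyDemuthRandom Z) : SufficientlyGenericAre fun x => x ∉ H := by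
  obtain ⟨G, hG, rfl⟩ := hH
  refine ⟨Set.range fun n => {P : MLTree | paths P.tree ∩ G n = ∅}, Set.countable_range _,
    fun x hx hxH => ?_⟩
  obtain ⟨n, hn⟩ := Set.mem_iUnion.1 hxH
  exact hx.notMem ⟨n, rfl⟩ (forcingDense_avoid_of_isGδ (hG n) fun Z hZ =>
    hHr Z (Set.mem_iUnion.2 ⟨n, hZ⟩)) hn

/-- Meeting these sets for all `n` leaves at most one real on all trees of a filter. -/
lemma forcingDense_subset_cylinder (n : ℕ) :
    ForcingDense {P : MLTree | ∃ σ, σ.length = n ∧ paths P.tree ⊆ cylinder σ} := by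
  intro P
  obtain ⟨Z, hZ⟩ := P.nonempty
  have hne : (paths P.tree ∩ paths {τ | initSeg Z n <+: τ ∨ τ <+: initSeg Z n}).Nonempty :=
    ⟨Z, hZ, by rw [paths_comparable]; simp [cylinder]⟩
  refine ⟨P.restrict _ (isRecursiveTree_comparable _) hne, ⟨initSeg Z n, by simp, ?_⟩,
    P.restrict_le _ _ _⟩
  rw [P.paths_restrict, paths_comparable]
  exact Set.inter_subset_right

theorem exists_genericFor {𝒟 : Set (Set MLTree)} (h𝒟 : 𝒟.Countable) (P : MLTree) :
    ∃ x ∈ paths P.tree, GenericFor 𝒟 x := by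
  have := h𝒟.to_subtype
  -- The filter is to meet the dense members of `𝒟` together with the cylinder sets of every length.
  let ι := {D : 𝒟 // ForcingDense D.1} ⊕ ℕ
  have : Nonempty (Encodable ι) := Encodable.nonempty_encodable.2 inferInstance
  obtain ⟨_⟩ := this
  let C (D : Set MLTree) (hD : ForcingDense D) : Order.Cofinal MLTreeᵒᵈ :=
    { carrier := OrderDual.ofDual ⁻¹' D
      isCofinal := fun Q => (hD (OrderDual.ofDual Q)).elim fun R hR => ⟨OrderDual.toDual R, hR⟩ }
  let E : ι → Order.Cofinal MLTreeᵒᵈ :=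
    Sum.elim (fun D => C D.1.1 D.2) fun n => C _ (forcingDense_subset_cylinder n)
  let F : Order.PFilter MLTree := ⟨Order.idealOfCofinals (OrderDual.toDual P) E⟩
  have hP : P ∈ F := Order.mem_idealOfCofinals _ E
  have hmeet (D : Set MLTree) (hD : D ∈ 𝒟) (hdense : ForcingDense D) : ∃ Q ∈ F, Q ∈ D := by
    obtain ⟨Q, hQD, hQF⟩ := Order.cofinal_meets_idealOfCofinals (OrderDual.toDual P) E
      (Sum.inl ⟨⟨D, hD⟩, hdense⟩)
    exact ⟨OrderDual.ofDual Q, hQF, hQD⟩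
  have hcyl (n : ℕ) : ∃ Q ∈ F, ∃ σ, σ.length = n ∧ paths Q.tree ⊆ cylinder σ := by
    obtain ⟨Q, hQD, hQF⟩ := Order.cofinal_meets_idealOfCofinals (OrderDual.toDual P) E (Sum.inr n)
    exact ⟨OrderDual.ofDual Q, hQF, hQD⟩
  -- The path classes are nonempty, compact and directed downwards, so they have a common point.
  have hne : (⋂ Q : {Q // Q ∈ F}, paths Q.1.tree).Nonempty := by
    have : Nonempty {Q // Q ∈ F} := ⟨⟨P, hP⟩⟩
    refine IsCompact.nonempty_iInter_of_directed_nonempty_isCompact_isClosed _ ?_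
      (fun Q => Q.1.nonempty) (fun Q => (isClosed_paths _).isCompact) fun Q => isClosed_paths _
    rintro ⟨Q, hQ⟩ ⟨R, hR⟩
    obtain ⟨N, hN, hNQ, hNR⟩ := F.directed Q hQ R hR
    exact ⟨⟨N, hN⟩, MLTree.paths_mono hNQ, MLTree.paths_mono hNR⟩
  obtain ⟨x, hx⟩ := hne
  rw [Set.mem_iInter] at hx
  refine ⟨x, hx ⟨P, hP⟩, F, hmeet, Set.eq_singleton_iff_unique_mem.2
    ⟨Set.mem_iInter₂.2 fun Q hQ => hx ⟨Q, hQ⟩, fun y hy => ?_⟩⟩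
  rw [Set.mem_iInter₂] at hy
  funext i
  obtain ⟨Q, hQ, σ, hσ, hsub⟩ := hcyl (i + 1)
  have hxσ := (initSeg_eq_iff_mem_cylinder hσ).2 (hsub (hx ⟨Q, hQ⟩))
  have hyσ := (initSeg_eq_iff_mem_cylinder hσ).2 (hsub (hy Q hQ))
  exact initSeg_eq_iff.1 (hyσ.trans hxσ.symm) i (Nat.lt_succ_self i)

lemma GenericFor.mono {𝒟 ℰ : Set (Set MLTree)} (h : 𝒟 ⊆ ℰ) {x : Cantor} (hx : GenericFor ℰ x) :
    GenericFor 𝒟 x := by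
  obtain ⟨F, hF, hFx⟩ := hx
  exact ⟨F, fun D hD => hF D (h hD), hFx⟩

theorem exists_weaklyDemuthRandom_notMem {H : Set Cantor} (hH : BoldSigma03 H)
    (hHr : ∀ Z ∈ H, WeaklyDemuthRandom Z) : ∃ Z, WeaklyDemuthRandom Z ∧ Z ∉ H := by
  obtain ⟨𝒟, h𝒟, hr⟩ := sufficientlyGeneric_random
  obtain ⟨ℰ, hℰ, hn⟩ := sufficientlyGeneric_notMem hH hHr
  obtain ⟨P⟩ := nonempty_mlTree
  -- One real must be generic for both families at once, hence the union.
  obtain ⟨x, -, hx⟩ := exists_genericFor (h𝒟.union hℰ) P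
  exact ⟨x, (hr x (hx.mono Set.subset_union_left)).2, hn x (hx.mono Set.subset_union_right)⟩

end WeakDemuth

theorem mainTheorem12 :
    (∀ T : Set (List Bool), WeakDemuth.IsRecursiveTree T →
      (∀ Z ∈ WeakDemuth.paths T, WeakDemuth.MLRandom Z) →
      ∃ S : ℕ → Set WeakDemuth.Cantor, WeakDemuth.IsDemuthTest S ∧
        ∀ σ : List Bool, (WeakDemuth.cylinder σ ∩ WeakDemuth.paths T).Nonempty →
          (WeakDemuth.cylinder σ ∩ WeakDemuth.paths T ∩ ⋂ i, S i).Nonempty) ∧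
    (∀ G : Set WeakDemuth.Cantor, WeakDemuth.BoldPi02 G →
      (∀ Z ∈ G, WeakDemuth.WeaklyDemuthRandom Z) →
      WeakDemuth.ForcingDense
        {P : WeakDemuth.MLTree | WeakDemuth.paths P.tree ∩ G = ∅}) ∧
    Nonempty WeakDemuth.MLTree ∧
    (∀ 𝒟 : Set (Set WeakDemuth.MLTree), 𝒟.Countable → ∀ P : WeakDemuth.MLTree,
      ∃ x ∈ WeakDemuth.paths P.tree, WeakDemuth.GenericFor 𝒟 x) ∧
    WeakDemuth.SufficientlyGenericAre
      (fun x => WeakDemuth.WeaklyTwoRandom x ∧ WeakDemuth.WeaklyDemuthRandom x) ∧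
    (∀ H : Set WeakDemuth.Cantor, WeakDemuth.BoldSigma03 H →
      (∀ Z ∈ H, WeakDemuth.WeaklyDemuthRandom Z) →
      WeakDemuth.SufficientlyGenericAre (fun x => x ∉ H) ∧
      ∃ Z, WeakDemuth.WeaklyDemuthRandom Z ∧ Z ∉ H) ∧
    ¬ WeakDemuth.BoldSigma03 {Z | WeakDemuth.WeaklyDemuthRandom Z} := by
  refine ⟨fun T hT _ => ?_, fun G hG hGr => WeakDemuth.forcingDense_avoid_of_isGδ hG hGr,
    WeakDemuth.nonempty_mlTree, fun 𝒟 h𝒟 P => WeakDemuth.exists_genericFor h𝒟 P,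
    WeakDemuth.sufficientlyGeneric_random, fun H hH hHr =>
      ⟨WeakDemuth.sufficientlyGeneric_notMem hH hHr,
        WeakDemuth.exists_weaklyDemuthRandom_notMem hH hHr⟩, fun h => ?_⟩
  · obtain ⟨S, hS, -, hd⟩ := WeakDemuth.exists_demuthTest_iInter_dense hT
    exact ⟨S, hS, hd⟩
  · obtain ⟨Z, hZ, hZ'⟩ := WeakDemuth.exists_weaklyDemuthRandom_notMem h fun _ hZ => hZ
    exact hZ' hZ
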